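/- Let $(D,\mu)$ be a probability space, let $m\ge 1$, and let $V_m$ be an $m$-dimensional complex linear space of bounded, square-integrable functions $f\colon D\to\mathbb C$ (genuine functions, not equivalence classes). For $f\in V_m$ write $\|f\|_p=\|f\|_{L_p(D,\mu)}$ for $2\le p<\infty$ and $\|f\|_\infty=\sup_{x\in D}|f(x)|$; put $1/\infty=0$. 1. For every integer $n\ge m$ there exist points $x_1,\dots,x_{2n}\in D$ such that, for all $f\in V_m$ and all $2\le p\le\infty$, $$\Big(1-\sqrt{\tfrac mn}\Big)\,\|f\|_p\;\le\; m^{\frac12-\frac1p}\,\sqrt{\frac1n\sum_{i=1}^{2n}|f(x_i)|^2}.$$ 2. For every integer $n\ge m$ and each single $p\in\{2,\infty\}$, $n$ points suffice: there exist $x_1,\dots,x_n\in D$ (depending on $p$) such that, for all $f\in V_m$, $$\Big(1-\sqrt{\tfrac mn}\Big)\,\|f\|_p\;\le\; m^{\frac12-\frac1p}\,\sqrt{\frac1n\sum_{i=1}^{n}|f(x_i)|^2}.$$ 3. In the case $n=m$, both 1 and 2 also hold with the factor $1-\sqrt{m/n}$ replaced by $\frac1{2m}$. 4. There exist points $x_1,\dots,x_{2m}\in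 D$ such that, for all $f\in V_m$, $$\|f\|_\infty\;\le\;(2+\sqrt2)\,\sqrt m\,\max_{1\le i\le 2m}|f(x_i)|.$$ -/

import Mathlib

open MeasureTheory
open scoped ENNReal

/-- The norm `‖f‖_p` of a complex-valued function `f` (a genuine function, not an equivalence
class): for `p < ∞` it is the `L_p(D, μ)`-norm, for `p = ∞` it is the supremum norm
`sup_{x ∈ D} |f x|` of the space of bounded functions, which dominates the essential supremum. -/
noncomputable def pNorm {D : Type*} [MeasurableSpace D] (μ : Measure D) (p : ℝ≥0∞)
    (f : D → ℂ) : ℝ :=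
  if p = ∞ then ⨆ x, ‖f x‖ else (eLpNorm f p μ).toReal

/-! Both sampling bounds come from a one-sided barrier argument with unit weights. If the identity
is an average of matrices `v vᴴ`, `v ∈ S`, in dimension `k`, then for `n > k` some `n` vectors of
`S` satisfy `∑ v vᴴ ≥ (√n - √k)² · 1` (`exists_frame_lower_bound`). They are chosen greedily: each
step replaces `M` by `M - δ + v vᴴ` without raising the potential `tr M⁻¹` above its initial bound.
Since only a lower frame bound is needed, no reweighting occurs.

For `p = 2` the vectors are the values of an `L₂`-orthonormal system, whose second-moment matrix is
the identity. For `p = ∞` a D-optimal design supplies coordinates in which the identity is again an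
average, while every evaluation vector has squared length at most `m`; Cauchy–Schwarz then turns the
frame bound into a uniform bound. Averages are taken in the closed hull `momentHull`, so optimal
designs exist without any topology on `D`, while the barrier still selects genuine points.

Concatenating the two point sets and interpolating between `L₂` and the supremum norm gives all `2 ≤
p ≤ ∞`. When `n = m` the factor `1 - √(m/n)` vanishes; the replacement `1/(2m)` comes from
approximate Fekete points and Lagrange interpolation. -/

section Barrier

/-! ### Moment hulls, spectral calculus and the barrier argument -/

open Matrix
open scoped ComplexOrder

variable {ι : Type*} [Fintype ι] [DecidableEq ι]

/-- The closed convex hull of the rank-one matrices `v vᴴ`, `v ∈ S`, described through its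
supporting half-spaces. -/
def momentHull (S : Set (ι → ℂ)) : Set (Matrix ι ι ℂ) :=
  {G | G.IsHermitian ∧ ∀ B : Matrix ι ι ℂ, B.IsHermitian → ∀ c : ℝ,
    (∀ v ∈ S, (star v ⬝ᵥ B *ᵥ v).re ≤ c) → (B * G).trace.re ≤ c}

omit [DecidableEq ι] in
theorem trace_mul_vecMulVec_star (B : Matrix ι ι ℂ) (v : ι → ℂ) :
    (B * vecMulVec v (star v)).trace = star v ⬝ᵥ B *ᵥ v := by
  rw [mul_vecMulVec, trace_vecMulVec, dotProduct_comm]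

omit [DecidableEq ι] in
theorem vecMulVec_mem_momentHull {S : Set (ι → ℂ)} {v : ι → ℂ} (hv : v ∈ S) :
    vecMulVec v (star v) ∈ momentHull S := by
  refine ⟨(posSemidef_vecMulVec_self_star v).isHermitian, fun B _ c h => ?_⟩
  rw [trace_mul_vecMulVec_star]
  exact h v hv

omit [DecidableEq ι] in
theorem mul_mul_conjTranspose_mem_momentHull {S : Set (ι → ℂ)} {G : Matrix ι ι ℂ}
    (hG : G ∈ momentHull S) (P : Matrix ι ι ℂ) :
    P * G * Pᴴ ∈ momentHull ((fun v => P *ᵥ v) '' S) := by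
  refine ⟨isHermitian_mul_mul_conjTranspose P hG.1, fun B hB c h => ?_⟩
  have key := hG.2 (Pᴴ * B * P) (isHermitian_conjTranspose_mul_mul P hB) c (fun v hv => by
    have := h _ ⟨v, hv, rfl⟩
    simpa only [star_mulVec, ← dotProduct_mulVec, mulVec_mulVec, Matrix.mul_assoc] using this)
  have e : (B * (P * G * Pᴴ)).trace = (Pᴴ * B * P * G).trace := by
    rw [← Matrix.mul_assoc, trace_mul_comm]
    simp only [Matrix.mul_assoc]
  rwa [e]

/-- The matrix with eigenvalues `g` in the orthonormal basis given by the columns of `U`. -/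
noncomputable def spectralMatrix (U : Matrix ι ι ℂ) (g : ι → ℝ) : Matrix ι ι ℂ :=
  U * diagonal (fun i => (g i : ℂ)) * Uᴴ

theorem Matrix.IsHermitian.exists_eq_spectralMatrix {A : Matrix ι ι ℂ} (hA : A.IsHermitian) :
    ∃ (U : Matrix ι ι ℂ) (d : ι → ℝ), Uᴴ * U = 1 ∧ A = spectralMatrix U d := by
  refine ⟨hA.eigenvectorUnitary, hA.eigenvalues, ?_, ?_⟩
  · rw [← star_eq_conjTranspose]; simp
  · conv_lhs => rw [hA.spectral_theorem]
    rw [Unitary.conjStarAlgAut_apply]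
    rfl

section
variable {U : Matrix ι ι ℂ}

theorem spectralMatrix_mul (hU : Uᴴ * U = 1) (g h : ι → ℝ) :
    spectralMatrix U g * spectralMatrix U h = spectralMatrix U (fun i => g i * h i) := by
  have : spectralMatrix U g * spectralMatrix U h =
      U * diagonal (fun i => (g i : ℂ)) * (Uᴴ * U) * diagonal (fun i => (h i : ℂ)) * Uᴴ := by
    simp only [spectralMatrix, Matrix.mul_assoc]
  rw [this, hU, Matrix.mul_one, Matrix.mul_assoc U, diagonal_mul_diagonal]
  simp [spectralMatrix]

theorem spectralMatrix_sub (g h : ι → ℝ) :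
    spectralMatrix U g - spectralMatrix U h = spectralMatrix U (fun i => g i - h i) := by
  simp only [spectralMatrix, ← Matrix.sub_mul, ← Matrix.mul_sub, diagonal_sub, Complex.ofReal_sub]

theorem spectralMatrix_const (hU : Uᴴ * U = 1) (c : ℝ) :
    spectralMatrix U (fun _ => c) = (c : ℂ) • 1 := by
  have hU' : U * Uᴴ = 1 := mul_eq_one_comm.mp hU
  have : (diagonal fun _ : ι => (c : ℂ)) = (c : ℂ) • 1 := by
    rw [smul_one_eq_diagonal]
  rw [spectralMatrix, this, mul_smul_comm, smul_mul_assoc, Matrix.mul_one, hU']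

theorem trace_spectralMatrix (hU : Uᴴ * U = 1) (g : ι → ℝ) :
    (spectralMatrix U g).trace = ((∑ i, g i : ℝ) : ℂ) := by
  rw [spectralMatrix, trace_mul_comm, ← Matrix.mul_assoc, hU, Matrix.one_mul, trace_diagonal]
  simp

theorem star_dotProduct_spectralMatrix (g : ι → ℝ) (v : ι → ℂ) :
    star v ⬝ᵥ spectralMatrix U g *ᵥ v = ((∑ i, g i * ‖(Uᴴ *ᵥ v) i‖ ^ 2 : ℝ) : ℂ) := by
  have : star v ⬝ᵥ spectralMatrix U g *ᵥ v =
      star (Uᴴ *ᵥ v) ⬝ᵥ diagonal (fun i => (g i : ℂ)) *ᵥ (Uᴴ *ᵥ v) := by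
    simp only [spectralMatrix, star_mulVec, ← dotProduct_mulVec, mulVec_mulVec, Matrix.mul_assoc,
      conjTranspose_conjTranspose]
  rw [this]
  simp only [dotProduct, mulVec_diagonal, Pi.star_apply, RCLike.star_def]
  push_cast
  refine Finset.sum_congr rfl fun i _ => ?_
  rw [← Complex.conj_mul']
  ring

theorem isHermitian_spectralMatrix (g : ι → ℝ) : (spectralMatrix U g).IsHermitian :=
  isHermitian_mul_mul_conjTranspose U
    (isHermitian_diagonal_of_self_adjoint _ (by ext i; simp))

theorem posDef_spectralMatrix_iff (hU : Uᴴ * U = 1) {g : ι → ℝ} :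
    (spectralMatrix U g).PosDef ↔ ∀ i, 0 < g i := by
  have hU' : IsUnit U := ⟨⟨U, Uᴴ, mul_eq_one_comm.mp hU, hU⟩, rfl⟩
  rw [spectralMatrix, ← star_eq_conjTranspose, IsUnit.posDef_star_right_conjugate_iff hU',
    posDef_diagonal_iff]
  simp

theorem inv_spectralMatrix (hU : Uᴴ * U = 1) {g : ι → ℝ} (hg : ∀ i, 0 < g i) :
    (spectralMatrix U g)⁻¹ = spectralMatrix U (fun i => (g i)⁻¹) := by
  refine inv_eq_right_inv ?_
  rw [spectralMatrix_mul hU]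
  simp only [fun i => mul_inv_cancel₀ (hg i).ne']
  rw [spectralMatrix_const hU]; simp

end

/-- Sherman–Morrison formula for a Hermitian rank-one update. -/
theorem inv_add_vecMulVec_star {Z Y : Matrix ι ι ℂ} (hZY : Z * Y = 1) (v : ι → ℂ)
    (hq : 1 + star v ⬝ᵥ Y *ᵥ v ≠ 0) :
    (Z + vecMulVec v (star v))⁻¹ =
      Y - (1 + star v ⬝ᵥ Y *ᵥ v)⁻¹ • vecMulVec (Y *ᵥ v) (star v ᵥ* Y) := by
  refine inv_eq_right_inv ?_
  set q := star v ⬝ᵥ Y *ᵥ v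
  rw [Matrix.add_mul, Matrix.mul_sub, Matrix.mul_sub, mul_smul_comm, mul_smul_comm, mul_vecMulVec,
    mulVec_mulVec, hZY, one_mulVec, vecMulVec_mul, vecMulVec_mul_vecMulVec]
  have e : (star v ⬝ᵥ Y *ᵥ v) = q := rfl
  rw [e]
  rw [vecMulVec_smul, smul_smul]
  have hc : (1 + q)⁻¹ + (1 + q)⁻¹ * q = 1 := by field_simp
  have : vecMulVec v (star v ᵥ* Y) =
      (1 + q)⁻¹ • vecMulVec v (star v ᵥ* Y) + ((1 + q)⁻¹ * q) • vecMulVec v (star v ᵥ* Y) := by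
    rw [← add_smul, hc, one_smul]
  nth_rewrite 2 [this]
  abel

omit [DecidableEq ι] in
/-- The scalar inequality behind a barrier step. -/
theorem barrier_sum_lt [Nonempty ι] {d : ι → ℝ} {φ δ : ℝ} (hd : ∀ i, 0 < d i) (hδ : 0 < δ)
    (hφ : ∑ i, (d i)⁻¹ ≤ φ) (hδφ : δ * (1 + φ) < 1) (hdδ : ∀ i, 0 < d i - δ) :
    (∑ i, (d i - δ)⁻¹ - ∑ i, (d i)⁻¹) * (1 + ∑ i, (d i - δ)⁻¹) < ∑ i, (d i - δ)⁻¹ ^ 2 := by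
  set x : ι → ℝ := fun i => (d i)⁻¹ with hx
  set y : ι → ℝ := fun i => (d i - δ)⁻¹ with hy
  have hx0 : ∀ i, 0 < x i := fun i => inv_pos.mpr (hd i)
  have hy0 : ∀ i, 0 < y i := fun i => inv_pos.mpr (hdδ i)
  have hxy : ∀ i, y i - x i = δ * (x i * y i) := fun i => by
    have := (hd i).ne'
    have := (hdδ i).ne'
    simp only [hx, hy]; field_simp; ring
  set T := ∑ i, x i * y i with hT
  have hT0 : 0 < T := Finset.sum_pos (fun i _ => mul_pos (hx0 i) (hy0 i)) Finset.univ_nonempty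
  have hΔ : ∑ i, y i - ∑ i, x i = δ * T := by
    rw [← Finset.sum_sub_distrib, hT, Finset.mul_sum]
    exact Finset.sum_congr rfl fun i _ => hxy i
  have hcs : T ^ 2 ≤ (∑ i, x i) * ∑ i, x i * y i ^ 2 := by
    refine Finset.sum_sq_le_sum_mul_sum_of_sq_le_mul _ (fun i _ => (hx0 i).le)
      (fun i _ => mul_nonneg (hx0 i).le (sq_nonneg _)) (fun i _ => by ring_nf; rfl)
  have hy2 : ∑ i, y i ^ 2 = T + δ * ∑ i, x i * y i ^ 2 := by
    rw [hT, Finset.mul_sum, ← Finset.sum_add_distrib]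
    refine Finset.sum_congr rfl fun i _ => ?_
    linear_combination (y i) * hxy i
  change (∑ i, y i - ∑ i, x i) * (1 + ∑ i, y i) < ∑ i, y i ^ 2
  have hs : ∑ i, y i = ∑ i, x i + δ * T := by linarith
  -- With `X = ∑ x` and `W = ∑ x y²` the goal becomes `δT(1 + X + δT) < T + δW`. The part `δT(1 + X)
  -- < T` is the hypothesis on `δ`; the part `δ²T² ≤ δW` is Cauchy–Schwarz with `δX ≤ 1`.
  rw [hΔ, hy2, hs]
  have hW : 0 ≤ ∑ i, x i * y i ^ 2 :=
    Finset.sum_nonneg fun i _ => mul_nonneg (hx0 i).le (sq_nonneg _)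
  have hX : 0 ≤ ∑ i, x i := Finset.sum_nonneg fun i _ => (hx0 i).le
  generalize ∑ i, x i * y i ^ 2 = W at *
  change ∑ i, x i ≤ φ at hφ
  generalize ∑ i, x i = X at *
  have h1 : δ * (1 + X) < 1 := lt_of_le_of_lt (by gcongr) hδφ
  have h2 : δ * X ≤ 1 := by nlinarith
  have h3 : δ * T ^ 2 ≤ W := by
    calc δ * T ^ 2 ≤ δ * (X * W) := by gcongr
      _ = (δ * X) * W := by ring
      _ ≤ 1 * W := by gcongr
      _ = W := one_mul _
  have h4 : δ * (1 + X) * T < 1 * T := by gcongr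
  have h5 : δ * (δ * T ^ 2) ≤ δ * W := by gcongr
  nlinarith

/-- The trace of the inverse dominates the reciprocal of each eigenvalue, so all eigenvalues are at
least `1/φ > δ`. -/
theorem Matrix.PosDef.sub_smul_one {M : Matrix ι ι ℂ} (hM : M.PosDef) {φ δ : ℝ}
    (hφ : M⁻¹.trace.re ≤ φ) (hδ : 0 < δ) (hδφ : δ * φ < 1) : (M - (δ : ℂ) • 1).PosDef := by
  obtain ⟨U, d, hU, rfl⟩ := hM.isHermitian.exists_eq_spectralMatrix
  have hd := (posDef_spectralMatrix_iff hU).mp hM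
  rw [inv_spectralMatrix hU hd, trace_spectralMatrix hU, Complex.ofReal_re] at hφ
  rw [← spectralMatrix_const hU, spectralMatrix_sub, posDef_spectralMatrix_iff hU]
  intro i
  have h1 : (d i)⁻¹ ≤ φ := le_trans
    (Finset.single_le_sum (fun j _ => (inv_pos.mpr (hd j)).le) (Finset.mem_univ i)) hφ
  have h2 : δ * (d i)⁻¹ < 1 := lt_of_le_of_lt (by gcongr) hδφ
  have h3 := hd i
  rw [← div_eq_mul_inv, div_lt_one h3] at h2
  linarith

/-- Let `Y = (M - δ)⁻¹`. The shift raises the potential by `Δ`, and by Sherman–Morrison adding `v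
vᴴ` lowers it by `vᴴY²v / (1 + vᴴYv)`. An averaging argument finds a `v` for which the gain covers
the loss. -/
theorem exists_barrier_step [Nonempty ι] {S : Set (ι → ℂ)} (hS : 1 ∈ momentHull S)
    {M : Matrix ι ι ℂ} (hM : M.PosDef) {φ δ : ℝ} (hφ : M⁻¹.trace.re ≤ φ) (hδ : 0 < δ)
    (hδφ : δ * (1 + φ) < 1) :
    ∃ v ∈ S, (M - (δ : ℂ) • 1 + vecMulVec v (star v)).PosDef ∧
      (M - (δ : ℂ) • 1 + vecMulVec v (star v))⁻¹.trace.re ≤ φ := by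
  have hZ : (M - (δ : ℂ) • 1).PosDef := hM.sub_smul_one hφ hδ (by linarith)
  obtain ⟨U, d, hU, rfl⟩ := hM.isHermitian.exists_eq_spectralMatrix
  have hd := (posDef_spectralMatrix_iff hU).mp hM
  rw [inv_spectralMatrix hU hd, trace_spectralMatrix hU, Complex.ofReal_re] at hφ
  rw [← spectralMatrix_const hU, spectralMatrix_sub] at hZ ⊢
  have hdδ := (posDef_spectralMatrix_iff hU).mp hZ
  have hsum := barrier_sum_lt hd hδ hφ hδφ hdδ
  set y : ι → ℝ := fun i => (d i - δ)⁻¹ with hy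
  have hy0 : ∀ i, 0 < y i := fun i => inv_pos.mpr (hdδ i)
  set Δ := ∑ i, (d i - δ)⁻¹ - ∑ i, (d i)⁻¹ with hΔ
  -- The test matrix is `Y² - ΔY`. Its trace, which is its average over the hull representation of
  -- the identity, exceeds `Δ` by `barrier_sum_lt`, so its quadratic form exceeds `Δ` at some `v ∈
  -- S`.
  obtain ⟨v, hvS, hv⟩ : ∃ v ∈ S,
      Δ < (star v ⬝ᵥ spectralMatrix U (fun i => y i ^ 2 - Δ * y i) *ᵥ v).re := by
    by_contra! hcon
    have := hS.2 _ (isHermitian_spectralMatrix _) Δ hcon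
    rw [Matrix.mul_one, trace_spectralMatrix hU, Complex.ofReal_re, Finset.sum_sub_distrib,
      ← Finset.mul_sum] at this
    simp only [hy] at this
    linarith
  refine ⟨v, hvS, hZ.add_posSemidef (posSemidef_vecMulVec_self_star v), ?_⟩
  rw [star_dotProduct_spectralMatrix, Complex.ofReal_re] at hv
  have hYinv : spectralMatrix U (fun i => d i - δ) * spectralMatrix U y = 1 := by
    rw [spectralMatrix_mul hU]
    simp only [hy, fun i => mul_inv_cancel₀ (hdδ i).ne']
    rw [spectralMatrix_const hU]; simp
  set q := ∑ i, y i * ‖(Uᴴ *ᵥ v) i‖ ^ 2 with hq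
  have hq0 : 0 ≤ q := Finset.sum_nonneg fun i _ => mul_nonneg (hy0 i).le (sq_nonneg _)
  have hqq : 1 + star v ⬝ᵥ spectralMatrix U y *ᵥ v = ((1 + q : ℝ) : ℂ) := by
    rw [star_dotProduct_spectralMatrix, Complex.ofReal_add, Complex.ofReal_one]
  rw [inv_add_vecMulVec_star hYinv v (by
    rw [hqq]; exact_mod_cast (by positivity : (0:ℝ) < 1 + q).ne'), hqq, trace_sub, trace_smul,
    trace_vecMulVec, dotProduct_comm, ← dotProduct_mulVec, mulVec_mulVec, spectralMatrix_mul hU,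
    star_dotProduct_spectralMatrix, trace_spectralMatrix hU, smul_eq_mul, ← Complex.ofReal_inv,
    ← Complex.ofReal_mul, ← Complex.ofReal_sub, Complex.ofReal_re]
  have hsplit : ∑ i, (y i ^ 2 - Δ * y i) * ‖(Uᴴ *ᵥ v) i‖ ^ 2 =
      ∑ i, y i * y i * ‖(Uᴴ *ᵥ v) i‖ ^ 2 - Δ * q := by
    rw [hq, Finset.mul_sum, ← Finset.sum_sub_distrib]
    exact Finset.sum_congr rfl fun i _ => by ring
  rw [hsplit] at hv
  have hge : Δ ≤ (1 + q)⁻¹ * ∑ i, y i * y i * ‖(Uᴴ *ᵥ v) i‖ ^ 2 := by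
    rw [inv_mul_eq_div, le_div_iff₀ (by positivity)]
    linarith
  simp only [hy] at hge ⊢
  linarith

theorem exists_barrier_vectors [Nonempty ι] {S : Set (ι → ℂ)} (hS : 1 ∈ momentHull S)
    {t δ : ℝ} (ht : 0 < t) (hδ : 0 < δ) (hδt : δ * (1 + Fintype.card ι / t) < 1) (n : ℕ) :
    ∃ v : Fin n → ι → ℂ, (∀ i, v i ∈ S) ∧
      (((t - n * δ : ℝ) : ℂ) • 1 + ∑ i, vecMulVec (v i) (star (v i))).PosDef ∧
      (((t - n * δ : ℝ) : ℂ) • 1 + ∑ i, vecMulVec (v i) (star (v i)))⁻¹.trace.re ≤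
        Fintype.card ι / t := by
  induction n with
  | zero =>
    have h1 : (1 : Matrix ι ι ℂ)ᴴ * 1 = 1 := by simp
    refine ⟨Fin.elim0, fun i => i.elim0, ?_, ?_⟩
    · simp only [Nat.cast_zero, zero_mul, sub_zero, Finset.univ_eq_empty, Finset.sum_empty,
        add_zero]
      rw [← spectralMatrix_const h1, posDef_spectralMatrix_iff h1]
      exact fun _ => ht
    · simp only [Nat.cast_zero, zero_mul, sub_zero, Finset.univ_eq_empty, Finset.sum_empty,
        add_zero]
      rw [← spectralMatrix_const h1, inv_spectralMatrix h1 fun _ => ht, trace_spectralMatrix h1,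
        Complex.ofReal_re, Finset.sum_const, Finset.card_univ, nsmul_eq_mul, div_eq_mul_inv]
  | succ n ih =>
    obtain ⟨v, hv, hM, hφ⟩ := ih
    obtain ⟨u, hu, h1, h2⟩ := exists_barrier_step hS hM hφ hδ hδt
    have e : ((t - n * δ : ℝ) : ℂ) • 1 + ∑ i, vecMulVec (v i) (star (v i)) - (δ : ℂ) • 1
        + vecMulVec u (star u) = ((t - (n + 1 : ℕ) * δ : ℝ) : ℂ) • 1 +
        ∑ i, vecMulVec (Fin.snoc (α := fun _ => ι → ℂ) v u i)
          (star (Fin.snoc (α := fun _ => ι → ℂ) v u i)) := by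
      rw [Fin.sum_univ_castSucc]
      simp only [Fin.snoc_castSucc, Fin.snoc_last]
      have : ((t - (n + 1 : ℕ) * δ : ℝ) : ℂ) = ((t - n * δ : ℝ) : ℂ) - (δ : ℂ) := by
        push_cast; ring
      rw [this, sub_smul]
      abel
    rw [e] at h1 h2
    refine ⟨Fin.snoc (α := fun _ => ι → ℂ) v u, fun i => ?_, h1, h2⟩
    refine Fin.lastCases ?_ (fun j => ?_) i
    · simpa using hu
    · simpa using hv j

omit [DecidableEq ι] in
theorem star_dotProduct_vecMulVec_mulVec (v w : ι → ℂ) :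
    star (star w) ⬝ᵥ vecMulVec v (star v) *ᵥ star w = ((‖v ⬝ᵥ w‖ ^ 2 : ℝ) : ℂ) := by
  rw [vecMulVec_mulVec, star_star, dotProduct_smul]
  have : star v ⬝ᵥ star w = star (v ⬝ᵥ w) := by
    rw [star_dotProduct_star, dotProduct_comm]
  rw [this, dotProduct_comm w v, op_smul_eq_smul, smul_eq_mul, RCLike.star_def,
    Complex.conj_mul']
  push_cast; rfl

/-- `n` unit-weight vectors whose frame has lower bound `(√n - √k)²`, in dimension `k`. -/
theorem exists_frame_lower_bound {S : Set (ι → ℂ)} (hS : 1 ∈ momentHull S) {n : ℕ}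
    [Nonempty ι] (hn : Fintype.card ι < n) :
    ∃ v : Fin n → ι → ℂ, (∀ i, v i ∈ S) ∧ ∀ w : ι → ℂ,
      (√n - √(Fintype.card ι)) ^ 2 * ∑ j, ‖w j‖ ^ 2 ≤ ∑ i, ‖v i ⬝ᵥ w‖ ^ 2 := by
  have hk0 : (0 : ℝ) < Fintype.card ι := by exact_mod_cast Fintype.card_pos
  have hkn : (Fintype.card ι : ℝ) < n := by exact_mod_cast hn
  set k : ℝ := (Fintype.card ι : ℝ)
  have hn0 : (0 : ℝ) < n := hk0.trans hkn
  set a := √(n : ℝ)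
  set b := √k
  have ha : a ^ 2 = n := Real.sq_sqrt (by positivity)
  have hb : b ^ 2 = k := Real.sq_sqrt hk0.le
  have hb0 : 0 < b := Real.sqrt_pos.mpr hk0
  have hba : b < a := Real.sqrt_lt_sqrt hk0.le hkn
  have ha0 : 0 < a := hb0.trans hba
  -- This `t` maximizes `n t/(t + k) - t`, the bound reached in the limiting case `δ = t/(t + k) =
  -- (a - b)/a`.
  set t := b * (a - b) with ht
  have ht0 : 0 < t := mul_pos hb0 (sub_pos.mpr hba)
  -- The factor `n/(n + 1)` makes the barrier condition strict. Nothing is lost: after `n` steps the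
  -- potential still permits one more shift, and `(n + 1)δ = a(a - b)` exactly.
  set δ := n / (n + 1) * ((a - b) / a) with hδ
  have hδ0 : 0 < δ := mul_pos (by positivity) (div_pos (sub_pos.mpr hba) ha0)
  have hn1 : (n : ℝ) / (n + 1) < 1 := by rw [div_lt_one (by positivity)]; linarith
  have hδlt : δ < (a - b) / a := by
    have : 0 < (a - b) / a := div_pos (sub_pos.mpr hba) ha0
    calc δ < 1 * ((a - b) / a) := by rw [hδ]; gcongr
      _ = _ := one_mul _
  have hδt : δ * (1 + k / t) < 1 := by
    have h1 : 1 + k / t = ((a - b) / a)⁻¹ := by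
      have : a - b ≠ 0 := (sub_pos.mpr hba).ne'
      rw [← hb, ht]; field_simp; ring
    rw [h1, ← div_eq_mul_inv, div_lt_one (div_pos (sub_pos.mpr hba) ha0)]
    exact hδlt
  obtain ⟨v, hv, hM, hφ⟩ := exists_barrier_vectors hS ht0 hδ0 hδt n
  refine ⟨v, hv, fun w => ?_⟩
  have hpd := hM.sub_smul_one hφ hδ0 (by linarith)
  have h0 := (Complex.le_def.mp (hpd.posSemidef.dotProduct_mulVec_nonneg (star w))).1
  have e : t - n * δ - δ = - (a - b) ^ 2 := by
    have : (n : ℝ) + 1 ≠ 0 := by positivity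
    have : (n + 1) * δ = a * (a - b) := by
      rw [hδ]; field_simp; rw [ha]
    linear_combination ht - this
  have hsum : star (star w) ⬝ᵥ (∑ i, vecMulVec (v i) (star (v i))) *ᵥ star w =
      ((∑ i, ‖v i ⬝ᵥ w‖ ^ 2 : ℝ) : ℂ) := by
    rw [sum_mulVec, dotProduct_sum, Complex.ofReal_sum]
    exact Finset.sum_congr rfl fun i _ => star_dotProduct_vecMulVec_mulVec _ _
  have hww : star (star w) ⬝ᵥ star w = ((∑ j, ‖w j‖ ^ 2 : ℝ) : ℂ) := by
    rw [star_star, dotProduct, Complex.ofReal_sum]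
    refine Finset.sum_congr rfl fun i _ => ?_
    rw [Pi.star_apply, RCLike.star_def, Complex.mul_conj']
    push_cast; rfl
  rw [sub_mulVec, add_mulVec, smul_mulVec, smul_mulVec, one_mulVec, dotProduct_sub,
    dotProduct_add, dotProduct_smul, dotProduct_smul, hsum, hww, smul_eq_mul, smul_eq_mul,
    ← Complex.ofReal_mul, ← Complex.ofReal_mul, ← Complex.ofReal_add, ← Complex.ofReal_sub,
    Complex.ofReal_re, Complex.zero_re] at h0
  have : (t - n * δ) * ∑ j, ‖w j‖ ^ 2 - δ * ∑ j, ‖w j‖ ^ 2 = -(a - b) ^ 2 * ∑ j, ‖w j‖ ^ 2 := by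
    rw [← e]; ring
  linarith

end Barrier

/-! ### D-optimal designs, uniform-norm sampling and Fekete points -/

section Designs

open Matrix
open scoped ComplexOrder

variable {ι : Type*} [Fintype ι] [DecidableEq ι]

omit [DecidableEq ι] in
theorem momentHull_posSemidef {S : Set (ι → ℂ)} {G : Matrix ι ι ℂ} (hG : G ∈ momentHull S) :
    G.PosSemidef := by
  refine .of_dotProduct_mulVec_nonneg hG.1 fun x => ?_
  have h := hG.2 (-vecMulVec x (star x)) (posSemidef_vecMulVec_self_star x).isHermitian.neg 0
    (fun v _ => by
      have := (posSemidef_vecMulVec_self_star x).dotProduct_mulVec_nonneg v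
      have := (Complex.le_def.mp this).1
      simp only [neg_mulVec, dotProduct_neg, Complex.neg_re, Complex.zero_re] at this ⊢
      linarith)
  rw [Matrix.neg_mul, trace_neg, trace_mul_comm, trace_mul_vecMulVec_star] at h
  rw [Complex.le_def]
  refine ⟨by simpa using h, ?_⟩
  have := hG.1.im_star_dotProduct_mulVec_self x
  simpa using this.symm

omit [DecidableEq ι] in
theorem isClosed_momentHull (S : Set (ι → ℂ)) : IsClosed (momentHull S) := by
  have : momentHull S = {G : Matrix ι ι ℂ | Gᴴ = G} ∩
      ⋂ (B : Matrix ι ι ℂ) (_ : B.IsHermitian) (c : ℝ)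
        (_ : ∀ v ∈ S, (star v ⬝ᵥ B *ᵥ v).re ≤ c), {G | (B * G).trace.re ≤ c} := by
    ext G
    simp [momentHull, Matrix.IsHermitian]
  rw [this]
  refine (isClosed_eq (by fun_prop) continuous_id).inter ?_
  refine isClosed_iInter fun B => isClosed_iInter fun _ => isClosed_iInter fun c =>
    isClosed_iInter fun _ => isClosed_le ?_ continuous_const
  exact Complex.continuous_re.comp (Continuous.matrix_trace (by fun_prop))

/-- A Hermitian `B` supported on the entries `(i, j)` and `(j, i)` gives `tr(BG) = 2‖G i j‖²`, while
its form on `S` is at most `2R²‖G i j‖`. -/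
theorem norm_apply_le_of_mem_momentHull {S : Set (ι → ℂ)} {R : ℝ}
    (hR : ∀ v ∈ S, ∀ i, ‖v i‖ ≤ R) {G : Matrix ι ι ℂ} (hG : G ∈ momentHull S) (i j : ι) :
    ‖G i j‖ ≤ R ^ 2 := by
  set z : ℂ := star (G i j)
  set B : Matrix ι ι ℂ := Matrix.single j i z + (Matrix.single j i z)ᴴ
  have hB : B.IsHermitian := isHermitian_add_transpose_self _
  have hform : ∀ v : ι → ℂ, (star v ⬝ᵥ B *ᵥ v).re = 2 * (star (v j) * z * v i).re := by
    intro v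
    simp only [B, conjTranspose_single, add_mulVec, dotProduct_add, single_mulVec,
      Complex.add_re]
    simp [dotProduct, Function.update_apply]
    ring
  have key := hG.2 B hB (2 * (R * ‖z‖ * R)) (fun v hv => by
    rw [hform]
    have : ‖star (v j) * z * v i‖ ≤ R * ‖z‖ * R := by
      rw [norm_mul, norm_mul, norm_star]
      have := hR v hv i
      have := hR v hv j
      have : 0 ≤ R := (norm_nonneg _).trans this
      gcongr
    have := (Complex.re_le_norm _).trans this
    linarith)
  have htr : (B * G).trace.re = 2 * ‖G i j‖ ^ 2 := by
    have hji : G j i = star (G i j) := (hG.1.apply j i).symm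
    simp only [B, conjTranspose_single, Matrix.add_mul, trace_add, Complex.add_re]
    rw [trace_single_mul, trace_single_mul, hji]
    simp only [z, smul_eq_mul, RCLike.star_def, Complex.conj_mul', Complex.norm_conj]
    norm_cast
    ring
  rw [htr, norm_star] at key
  by_contra! hcon
  have hpos : 0 < ‖G i j‖ := lt_of_le_of_lt (sq_nonneg R) hcon
  nlinarith

theorem isCompact_momentHull {S : Set (ι → ℂ)} {R : ℝ} (hR : ∀ v ∈ S, ∀ i, ‖v i‖ ≤ R) :
    IsCompact (momentHull S) := by
  have hK : IsCompact (Set.pi Set.univ fun _ : ι => Set.pi Set.univ fun _ : ι =>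
      Metric.closedBall (0 : ℂ) (R ^ 2)) :=
    isCompact_univ_pi fun _ => isCompact_univ_pi fun _ => isCompact_closedBall _ _
  refine IsCompact.of_isClosed_subset (X := ι → ι → ℂ) hK (isClosed_momentHull S)
    fun G hG i _ j _ => ?_
  rw [mem_closedBall_zero_iff]
  exact norm_apply_le_of_mem_momentHull hR hG i j

omit [DecidableEq ι] in
theorem add_smul_vecMulVec_mem_momentHull {S : Set (ι → ℂ)} {G : Matrix ι ι ℂ}
    (hG : G ∈ momentHull S) {v : ι → ℂ} (hv : v ∈ S) {r : ℝ} (hr : 0 ≤ r) :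
    (1 + r)⁻¹ • (G + r • vecMulVec v (star v)) ∈ momentHull S := by
  have hV := vecMulVec_mem_momentHull hv
  refine ⟨(hG.1.add (hV.1.smul (IsSelfAdjoint.all r))).smul (IsSelfAdjoint.all _), fun B hB c h => ?_⟩
  have h1 := hG.2 B hB c h
  have h2 := hV.2 B hB c h
  rw [mul_smul_comm, Matrix.mul_add, mul_smul_comm, trace_smul, trace_add, trace_smul,
    Complex.smul_re, Complex.add_re, Complex.smul_re, smul_eq_mul, smul_eq_mul,
    inv_mul_le_iff₀ (by positivity)]
  nlinarith

/-- A number dominated by `((1 + r)^k - 1) / r` for all `r > 0` is at most `k`. -/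
theorem le_of_one_add_mul_le_pow {q : ℝ} {k : ℕ} (hk : 0 < k)
    (h : ∀ r : ℝ, 0 ≤ r → 1 + r * q ≤ (1 + r) ^ k) : q ≤ k := by
  by_contra! hcon
  have hk' : (0 : ℝ) < k := by exact_mod_cast hk
  have hq : 0 < q := hk'.trans hcon
  -- Since `(1 + r)^k ≤ exp(kr) ≤ 1/(1 - kr)`, any positive `r < (q - k)/(kq)` is contradictory;
  -- this is half that threshold.
  set r : ℝ := (q - k) / (2 * k * q) with hr
  have hr0 : 0 < r := div_pos (by linarith) (by positivity)
  have hkr : k * r * (2 * q) = q - k := by rw [hr]; field_simp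
  have hkr1 : 0 < 1 - k * r := by nlinarith
  have h1 : (1 + r) ^ k ≤ (1 - k * r)⁻¹ := by
    calc (1 + r) ^ k ≤ Real.exp r ^ k := by
          gcongr; linarith [Real.add_one_le_exp r]
      _ = (Real.exp (-(k * r)))⁻¹ := by rw [← Real.exp_nat_mul, Real.exp_neg, inv_inv]
      _ ≤ (1 - k * r)⁻¹ := by
          gcongr
          linarith [Real.add_one_le_exp (-(k * r))]
  have h2 := (h r hr0.le).trans h1
  rw [← one_div, le_div_iff₀ hkr1] at h2
  nlinarith

/-- Kiefer–Wolfowitz: a `D`-optimal design. After a linear change of coordinates `P`, the identity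
lies in the moment hull, while all vectors have squared length at most the dimension. -/
theorem exists_optimal_design [Nonempty ι] {S : Set (ι → ℂ)} {R : ℝ}
    (hR : ∀ v ∈ S, ∀ i, ‖v i‖ ≤ R) (hG : ∃ G ∈ momentHull S, G.det ≠ 0) :
    ∃ P : Matrix ι ι ℂ, IsUnit P ∧ 1 ∈ momentHull ((fun v => P *ᵥ v) '' S) ∧
      ∀ v ∈ S, ∑ i, ‖(P *ᵥ v) i‖ ^ 2 ≤ Fintype.card ι := by
  obtain ⟨G₀, hG₀, hdet₀⟩ := hG
  obtain ⟨G, hGS, hmax⟩ := (isCompact_momentHull hR).exists_isMaxOn ⟨G₀, hG₀⟩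
    (f := fun G => G.det.re)
    (Complex.continuous_re.comp (Continuous.matrix_det continuous_id)).continuousOn
  obtain ⟨U, d, hU, hGd⟩ := hGS.1.exists_eq_spectralMatrix
  have hd0 : 0 < G.det.re := by
    refine lt_of_lt_of_le ?_ (hmax hG₀)
    have h0 := (momentHull_posSemidef hG₀).det_nonneg
    exact (Complex.lt_def.mp (lt_of_le_of_ne h0 hdet₀.symm)).1
  have hGpd : G.PosDef := by
    refine (momentHull_posSemidef hGS).posDef_iff_isUnit.mpr ?_
    rw [isUnit_iff_isUnit_det, isUnit_iff_ne_zero]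
    rintro h
    rw [h] at hd0
    exact lt_irrefl _ hd0
  have hd := (posDef_spectralMatrix_iff hU).mp (hGd ▸ hGpd)
  -- `P` is an inverse square root of the maximizer `G` up to a unitary factor, so that `P G Pᴴ =
  -- 1`.
  set s : ι → ℂ := fun i => ((√(d i))⁻¹ : ℝ)
  set P : Matrix ι ι ℂ := diagonal s * Uᴴ with hP
  have hPG : P * G * Pᴴ = 1 := by
    have : P * G * Pᴴ = diagonal s * (Uᴴ * U) * diagonal (fun i => (d i : ℂ)) * (Uᴴ * U) *
        diagonal (star s) := by
      rw [hP, hGd, spectralMatrix, conjTranspose_mul, conjTranspose_conjTranspose,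
        diagonal_conjTranspose]
      simp only [Matrix.mul_assoc]
    rw [this, hU, Matrix.mul_one, Matrix.mul_one, diagonal_mul_diagonal, diagonal_mul_diagonal,
      ← diagonal_one]
    congr 1
    ext i
    have h1 : √(d i) ≠ 0 := (Real.sqrt_pos.mpr (hd i)).ne'
    have h2 : (√(d i))⁻¹ * d i * (√(d i))⁻¹ = 1 := by
      field_simp; exact (Real.sq_sqrt (hd i).le).symm
    simp only [s, Pi.star_apply, RCLike.star_def, Complex.conj_ofReal]
    exact_mod_cast h2
  have hPdet : ((‖P.det‖ ^ 2 : ℝ) : ℂ) * G.det = 1 := by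
    have := congrArg det hPG
    rw [det_mul, det_mul, det_conjTranspose, det_one] at this
    rw [← this]
    push_cast
    rw [← Complex.mul_conj', RCLike.star_def]
    ring
  refine ⟨P, ?_, hPG ▸ mul_mul_conjTranspose_mem_momentHull hGS P, fun v hv => ?_⟩
  · rw [isUnit_iff_isUnit_det, isUnit_iff_ne_zero]
    rintro h
    simp [h] at hPdet
  -- First-order optimality: moving from `G` towards `v vᴴ` multiplies the determinant by `(1 +
  -- r‖Pv‖²)/(1 + r)^k`, which cannot exceed 1.
  refine le_of_one_add_mul_le_pow Fintype.card_pos fun r hr => ?_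
  have hle := hmax (add_smul_vecMulVec_mem_momentHull hGS hv hr)
  set H := (1 + r)⁻¹ • (G + r • vecMulVec v (star v)) with hH
  set w := P *ᵥ v
  have e1 : P * H * Pᴴ = (1 + r)⁻¹ • (1 + r • vecMulVec w (star w)) := by
    rw [hH, mul_smul_comm, smul_mul_assoc, Matrix.mul_add, Matrix.add_mul, hPG, mul_smul_comm,
      smul_mul_assoc, mul_vecMulVec, vecMulVec_mul, star_mulVec]
  have e2 : (1 + r • vecMulVec w (star w)).det = ((1 + r * ∑ i, ‖w i‖ ^ 2 : ℝ) : ℂ) := by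
    rw [← smul_vecMulVec, vecMulVec_eq Unit, det_one_add_replicateCol_mul_replicateRow]
    simp only [dotProduct, Pi.star_apply, Pi.smul_apply, RCLike.star_def, Complex.real_smul]
    push_cast
    rw [Finset.mul_sum]
    congr 1
    refine Finset.sum_congr rfl fun i _ => ?_
    rw [← Complex.conj_mul']
    ring
  have e3 : (P * H * Pᴴ).det = ((‖P.det‖ ^ 2 : ℝ) : ℂ) * H.det := by
    rw [det_mul, det_mul, det_conjTranspose]
    push_cast
    rw [← Complex.mul_conj', RCLike.star_def]
    ring
  have e4 : (P * H * Pᴴ).det =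
      (((1 + r)⁻¹ ^ Fintype.card ι * (1 + r * ∑ i, ‖w i‖ ^ 2) : ℝ) : ℂ) := by
    rw [e1, ← Complex.coe_smul, det_smul, e2]
    push_cast; rfl
  have h5 : (1 + r)⁻¹ ^ Fintype.card ι * (1 + r * ∑ i, ‖w i‖ ^ 2) ≤ 1 := by
    have h6 := congrArg Complex.re hPdet
    have h7 := congrArg Complex.re (e4.symm.trans e3)
    rw [Complex.re_ofReal_mul] at h6 h7
    rw [Complex.ofReal_re] at h7
    rw [h7, ← Complex.one_re, ← h6]
    exact mul_le_mul_of_nonneg_left hle (sq_nonneg _)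
  rwa [inv_pow, inv_mul_le_iff₀ (by positivity), mul_one] at h5

/-- If no linear form vanishes on all `u y`, some `u (x i)` form a basis. -/
theorem exists_det_ne_zero {D : Type*} (u : D → ι → ℂ)
    (hu : ∀ c : ι → ℂ, (∀ y, u y ⬝ᵥ c = 0) → c = 0) :
    ∃ x : ι → D, (Matrix.of fun i => u (x i)).det ≠ 0 := by
  have hspan : Submodule.span ℂ (Set.range u) = ⊤ := by
    by_contra hne
    obtain ⟨f, hf0, hf⟩ := Submodule.exists_le_ker_of_lt_top _ (lt_top_iff_ne_top.mpr hne)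
    have hfv : ∀ v, f v = v ⬝ᵥ fun i => f (Pi.single i 1) := fun v => by
      conv_lhs => rw [pi_eq_sum_univ' v, map_sum]
      simp [dotProduct]
    refine hf0 (LinearMap.ext fun v => ?_)
    have h0 := hu (fun i => f (Pi.single i 1)) fun y => by
      rw [← hfv]
      exact hf (Submodule.subset_span ⟨y, rfl⟩)
    rw [hfv, h0]
    simp
  obtain ⟨b, hb, hbs, hli⟩ := exists_linearIndependent ℂ (Set.range u)
  have hB : ⊤ ≤ Submodule.span ℂ (Set.range ((↑) : b → ι → ℂ)) := by
    rw [Subtype.range_coe, hbs, hspan]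
  let e := (Pi.basisFun ℂ ι).indexEquiv (Module.Basis.mk hli hB)
  choose x hx using fun i : ι => hb (e i).2
  refine ⟨x, ?_⟩
  have hrows : LinearIndependent ℂ (Matrix.of fun i => u (x i)).row := by
    have : (Matrix.of fun i => u (x i)).row = ((↑) : b → ι → ℂ) ∘ e := funext fun i => hx i
    rw [this]
    exact hli.comp _ e.injective
  rw [linearIndependent_rows_iff_isUnit, isUnit_iff_isUnit_det] at hrows
  exact hrows.ne_zero

/-- The uniform average of `u uᴴ` over points whose evaluation vectors form a basis is nonsingular.
-/
theorem exists_mem_momentHull_det_ne_zero [Nonempty ι] {D : Type*} (u : D → ι → ℂ)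
    (hu : ∀ c : ι → ℂ, (∀ y, u y ⬝ᵥ c = 0) → c = 0) :
    ∃ G ∈ momentHull (Set.range u), G.det ≠ 0 := by
  obtain ⟨x, hx⟩ := exists_det_ne_zero u hu
  set M := Matrix.of fun i => u (x i)
  have hk : (0 : ℝ) < Fintype.card ι := by exact_mod_cast Fintype.card_pos
  have hsum : Mᵀ * (Mᵀ)ᴴ = ∑ i, vecMulVec (u (x i)) (star (u (x i))) := by
    ext a b
    simp [M, Matrix.mul_apply, Matrix.sum_apply, vecMulVec_apply]
  refine ⟨((Fintype.card ι : ℝ)⁻¹ : ℝ) • (Mᵀ * (Mᵀ)ᴴ),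
    ⟨(isHermitian_mul_conjTranspose_self _).smul (IsSelfAdjoint.all _),
      fun B hB c h => ?_⟩, ?_⟩
  · rw [mul_smul_comm, trace_smul, Complex.smul_re, smul_eq_mul, hsum, Matrix.mul_sum, trace_sum,
      Complex.re_sum, inv_mul_le_iff₀ hk]
    calc ∑ i, (B * vecMulVec (u (x i)) (star (u (x i)))).trace.re ≤ ∑ _i : ι, c := by
          refine Finset.sum_le_sum fun i _ => ?_
          rw [trace_mul_vecMulVec_star]
          exact h _ ⟨_, rfl⟩
      _ = Fintype.card ι * c := by simp
  · rw [← Complex.coe_smul, det_smul, det_mul, det_conjTranspose, det_transpose]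
    refine mul_ne_zero (pow_ne_zero _ ?_) (mul_ne_zero hx (star_ne_zero.mpr hx))
    exact_mod_cast (inv_pos.mpr hk).ne'

/-- Uniform-norm sampling with `n` points. -/
theorem exists_points_sup [Nonempty ι] {D : Type*} (u : D → ι → ℂ) {R : ℝ}
    (hR : ∀ y i, ‖u y i‖ ≤ R) (hu : ∀ c : ι → ℂ, (∀ y, u y ⬝ᵥ c = 0) → c = 0)
    {n : ℕ} (hn : Fintype.card ι < n) :
    ∃ x : Fin n → D, ∀ (c : ι → ℂ) (y : D),
      (√n - √(Fintype.card ι)) ^ 2 * ‖u y ⬝ᵥ c‖ ^ 2 ≤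
        Fintype.card ι * ∑ i, ‖u (x i) ⬝ᵥ c‖ ^ 2 := by
  obtain ⟨P, hP, hone, hlen⟩ := exists_optimal_design (S := Set.range u) (R := R)
    (by rintro _ ⟨y, rfl⟩; exact hR y) (exists_mem_momentHull_det_ne_zero u hu)
  obtain ⟨v, hv, hframe⟩ := exists_frame_lower_bound hone hn
  choose z hz hzv using hv
  choose x hx using hz
  refine ⟨x, fun c y => ?_⟩
  have hdet := (isUnit_iff_isUnit_det P).mp hP
  have hdot : ∀ y, (P *ᵥ u y) ⬝ᵥ (c ᵥ* P⁻¹) = u y ⬝ᵥ c := fun y => by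
    rw [dotProduct_comm, ← dotProduct_mulVec, mulVec_mulVec, nonsing_inv_mul _ hdet, one_mulVec,
      dotProduct_comm]
  have h1 := hframe (c ᵥ* P⁻¹)
  have h2 : ∀ i, v i ⬝ᵥ (c ᵥ* P⁻¹) = u (x i) ⬝ᵥ c := fun i => by
    rw [← hzv i, ← hx i]; exact hdot _
  simp only [h2] at h1
  have hcs : ‖u y ⬝ᵥ c‖ ^ 2 ≤ Fintype.card ι * ∑ j, ‖(c ᵥ* P⁻¹) j‖ ^ 2 := by
    rw [← hdot y]
    calc ‖(P *ᵥ u y) ⬝ᵥ (c ᵥ* P⁻¹)‖ ^ 2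
        ≤ (∑ i, ‖(P *ᵥ u y) i‖ * ‖(c ᵥ* P⁻¹) i‖) ^ 2 := by
          gcongr
          exact (norm_sum_le _ _).trans_eq (Finset.sum_congr rfl fun i _ => norm_mul _ _)
      _ ≤ (∑ i, ‖(P *ᵥ u y) i‖ ^ 2) * ∑ i, ‖(c ᵥ* P⁻¹) i‖ ^ 2 :=
          Finset.sum_mul_sq_le_sq_mul_sq _ _ _
      _ ≤ _ := by
          gcongr
          exact hlen _ ⟨y, rfl⟩
  calc (√n - √(Fintype.card ι)) ^ 2 * ‖u y ⬝ᵥ c‖ ^ 2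
      ≤ (√n - √(Fintype.card ι)) ^ 2 * (Fintype.card ι * ∑ j, ‖(c ᵥ* P⁻¹) j‖ ^ 2) := by gcongr
    _ = Fintype.card ι * ((√n - √(Fintype.card ι)) ^ 2 * ∑ j, ‖(c ᵥ* P⁻¹) j‖ ^ 2) := by ring
    _ ≤ _ := by gcongr

/-- Approximate Fekete points: Lagrange interpolation at `card ι` points with functions bounded
by `2`. -/
theorem exists_fekete_points {D : Type*} (u : D → ι → ℂ) {R : ℝ}
    (hR : ∀ y i, ‖u y i‖ ≤ R) (hu : ∀ c : ι → ℂ, (∀ y, u y ⬝ᵥ c = 0) → c = 0) :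
    ∃ x : ι → D, ∀ (c : ι → ℂ) (y : D), ‖u y ⬝ᵥ c‖ ≤ 2 * ∑ i, ‖u (x i) ⬝ᵥ c‖ := by
  obtain ⟨x₀, hx₀⟩ := exists_det_ne_zero u hu
  set F : (ι → D) → ℝ := fun x => ‖(Matrix.of fun i => u (x i)).det‖ with hF
  have hbdd : BddAbove (Set.range F) := by
    refine ⟨Nat.factorial (Fintype.card ι) • R ^ Fintype.card ι, ?_⟩
    rintro _ ⟨x, rfl⟩
    exact det_le (abv := NormedField.toAbsoluteValue ℂ) fun i j => hR (x i) j
  have hpos : 0 < ⨆ x, F x := lt_of_lt_of_le (norm_pos_iff.mpr hx₀) (le_ciSup hbdd x₀)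
  -- The supremum of the determinants need not be attained, so more than half of it is taken. By
  -- Cramer's rule the Lagrange coefficients are quotients of such determinants with one point
  -- exchanged, hence at most 2 in modulus.
  have : Nonempty (ι → D) := ⟨x₀⟩
  obtain ⟨x, hx⟩ := exists_lt_of_lt_ciSup (half_lt_self hpos)
  have hF0 : 0 < F x := lt_trans (half_pos hpos) hx
  have hle : ∀ x', F x' ≤ 2 * F x := fun x' => (le_ciSup hbdd x').trans (by linarith)
  refine ⟨x, fun c y => ?_⟩
  set M := Matrix.of fun i => u (x i) with hM
  have hcr := mulVec_cramer Mᵀ (u y)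
  have hid : M.det * (u y ⬝ᵥ c) = ∑ i, cramer Mᵀ (u y) i * (u (x i) ⬝ᵥ c) := by
    rw [det_transpose] at hcr
    rw [← smul_eq_mul, ← smul_dotProduct, ← hcr, mulVec_transpose, ← dotProduct_mulVec]
    rfl
  have hcb : ∀ i, ‖cramer Mᵀ (u y) i‖ ≤ 2 * F x := fun i => by
    have : cramer Mᵀ (u y) i = (Matrix.of fun j => u (Function.update x i y j)).det := by
      rw [cramer_transpose_apply]
      congr 1
      ext a b
      by_cases h : a = i
      · subst h; simp [hM]
      · simp [hM, h]
    rw [this]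
    exact hle _
  have h1 : F x * ‖u y ⬝ᵥ c‖ ≤ F x * (2 * ∑ i, ‖u (x i) ⬝ᵥ c‖) := by
    calc F x * ‖u y ⬝ᵥ c‖ = ‖M.det * (u y ⬝ᵥ c)‖ := (norm_mul _ _).symm
      _ ≤ ∑ i, ‖cramer Mᵀ (u y) i‖ * ‖u (x i) ⬝ᵥ c‖ := by
          rw [hid]
          exact (norm_sum_le _ _).trans_eq (Finset.sum_congr rfl fun i _ => norm_mul _ _)
      _ ≤ ∑ i, 2 * F x * ‖u (x i) ⬝ᵥ c‖ := by
          gcongr with i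
          exact hcb i
      _ = _ := by rw [← Finset.mul_sum]; ring
  exact le_of_mul_le_mul_left h1 hF0

end Designs

/-! ### Norm interpolation and `L₂`-sampling -/

section Sampling

variable {D : Type*} [MeasurableSpace D] {μ : Measure D}

theorem pNorm_top (f : D → ℂ) : pNorm μ ∞ f = ⨆ x, ‖f x‖ := if_pos rfl

theorem pNorm_of_ne_top {p : ℝ≥0∞} (hp : p ≠ ∞) (f : D → ℂ) :
    pNorm μ p f = (eLpNorm f p μ).toReal := if_neg hp

theorem pNorm_nonneg (p : ℝ≥0∞) (f : D → ℂ) : 0 ≤ pNorm μ p f := by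
  unfold pNorm
  split_ifs
  · exact Real.iSup_nonneg fun x => norm_nonneg _
  · exact ENNReal.toReal_nonneg

theorem norm_le_pNorm_top {f : D → ℂ} (hf : ∃ C : ℝ, ∀ x, ‖f x‖ ≤ C) (x : D) :
    ‖f x‖ ≤ pNorm μ ∞ f := by
  obtain ⟨C, hC⟩ := hf
  rw [pNorm_top]
  exact le_ciSup (f := fun x => ‖f x‖) ⟨C, by rintro _ ⟨x, rfl⟩; exact hC x⟩ x

theorem pNorm_two_le_pNorm_top [IsProbabilityMeasure μ] {f : D → ℂ}
    (hf : ∃ C : ℝ, ∀ x, ‖f x‖ ≤ C) : pNorm μ 2 f ≤ pNorm μ ∞ f := by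
  rw [pNorm_of_ne_top (by simp)]
  refine ENNReal.toReal_le_of_le_ofReal (pNorm_nonneg _ _) ?_
  refine (eLpNorm_le_of_ae_bound (C := pNorm μ ∞ f)
    (.of_forall fun x => norm_le_pNorm_top hf x)).trans ?_
  simp

/-- Interpolation between `L₂` and the supremum norm. -/
theorem pNorm_le_interpolation {f : D → ℂ} (hf : ∃ C : ℝ, ∀ x, ‖f x‖ ≤ C) (h2 : MemLp f 2 μ)
    {p : ℝ≥0∞} (hp : 2 ≤ p) (hp' : p ≠ ∞) :
    pNorm μ p f ≤ pNorm μ ∞ f ^ (1 - 2 / p.toReal) * pNorm μ 2 f ^ (2 / p.toReal) := by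
  set r := p.toReal with hr
  have hr2 : 2 ≤ r := by
    have := ENNReal.toReal_mono hp' hp
    simpa using this
  have hp0 : p ≠ 0 := (lt_of_lt_of_le (by norm_num) hp).ne'
  set K := pNorm μ ∞ f with hK
  have hK0 : 0 ≤ K := pNorm_nonneg _ _
  rw [pNorm_of_ne_top hp', pNorm_of_ne_top (by simp : (2 : ℝ≥0∞) ≠ ∞)]
  set k : ℝ≥0∞ := ENNReal.ofReal K
  have hfk : ∀ x, ‖f x‖ₑ ≤ k := fun x => by
    rw [← ofReal_norm]
    exact ENNReal.ofReal_le_ofReal (norm_le_pNorm_top hf x)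
  have hint : ∫⁻ x, ‖f x‖ₑ ^ r ∂μ ≤ k ^ (r - 2) * ∫⁻ x, ‖f x‖ₑ ^ (2 : ℝ) ∂μ := by
    rw [← lintegral_const_mul' _ _ (ENNReal.rpow_ne_top_of_nonneg (by linarith)
      ENNReal.ofReal_ne_top)]
    refine lintegral_mono fun x => ?_
    have : ‖f x‖ₑ ^ r = ‖f x‖ₑ ^ (r - 2) * ‖f x‖ₑ ^ (2 : ℝ) := by
      rw [← ENNReal.rpow_add_of_nonneg _ _ (by linarith) (by norm_num)]
      congr 1; ring
    rw [this]
    gcongr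
    exact hfk x
  have hE : eLpNorm f p μ ≤ k ^ (1 - 2 / r) * eLpNorm f 2 μ ^ (2 / r) := by
    rw [eLpNorm_eq_lintegral_rpow_enorm_toReal hp0 hp',
      eLpNorm_eq_lintegral_rpow_enorm_toReal (by simp) (by simp), ← hr, ENNReal.toReal_ofNat,
      ← ENNReal.rpow_mul]
    calc (∫⁻ x, ‖f x‖ₑ ^ r ∂μ) ^ (1 / r)
        ≤ (k ^ (r - 2) * ∫⁻ x, ‖f x‖ₑ ^ (2 : ℝ) ∂μ) ^ (1 / r) := by gcongr
      _ = _ := by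
        rw [ENNReal.mul_rpow_of_nonneg _ _ (by positivity), ← ENNReal.rpow_mul]
        congr 2
        · field_simp
        · field_simp
  have h2r : 2 / r ≤ 1 := by rw [div_le_one (by linarith)]; exact hr2
  have := ENNReal.toReal_mono (ENNReal.mul_ne_top
    (ENNReal.rpow_ne_top_of_nonneg (by linarith) ENNReal.ofReal_ne_top)
    (ENNReal.rpow_ne_top_of_nonneg (by positivity) h2.2.ne)) hE
  rwa [ENNReal.toReal_mul, ← ENNReal.toReal_rpow, ← ENNReal.toReal_rpow,
    ENNReal.toReal_ofReal hK0] at this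

/-- A geometric mean of the two endpoint bounds with `θ = 2/p`: the power of `m` becomes `(1 - θ)/2
= 1/2 - 1/p`. -/
theorem mul_pNorm_le_of_two_of_top {f : D → ℂ} (hf : ∃ C : ℝ, ∀ x, ‖f x‖ ≤ C)
    (h2 : MemLp f 2 μ) {c A m : ℝ} (hc : 0 ≤ c) (hA : 0 ≤ A) (hm : 0 < m)
    (hA2 : c * pNorm μ 2 f ≤ A) (hAtop : c * pNorm μ ∞ f ≤ m ^ (1 / 2 : ℝ) * A)
    {p : ℝ≥0∞} (hp : 2 ≤ p) :
    c * pNorm μ p f ≤ m ^ ((1 / 2 : ℝ) - (p⁻¹).toReal) * A := by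
  rcases eq_or_ne p ∞ with rfl | hp'
  · simpa using hAtop
  set r := p.toReal with hr
  have hr2 : 2 ≤ r := by
    have := ENNReal.toReal_mono hp' hp
    simpa using this
  set θ := 2 / r with hθ
  have hθ0 : 0 ≤ θ := by positivity
  have hθ1 : 0 ≤ 1 - θ := by
    rw [sub_nonneg, hθ, div_le_one (by linarith)]; exact hr2
  have hsplit : ∀ a : ℝ, 0 ≤ a → a = a ^ (1 - θ) * a ^ θ := fun a ha => by
    rw [← Real.rpow_add_of_nonneg ha hθ1 hθ0]; simp
  have hN := pNorm_nonneg (μ := μ) ∞ f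
  have hN2 := pNorm_nonneg (μ := μ) 2 f
  calc c * pNorm μ p f ≤ c * (pNorm μ ∞ f ^ (1 - θ) * pNorm μ 2 f ^ θ) := by
        gcongr
        exact pNorm_le_interpolation hf h2 hp hp'
    _ = (c * pNorm μ ∞ f) ^ (1 - θ) * (c * pNorm μ 2 f) ^ θ := by
        rw [Real.mul_rpow hc hN, Real.mul_rpow hc hN2]
        conv_lhs => rw [hsplit c hc]
        ring
    _ ≤ (m ^ (1 / 2 : ℝ) * A) ^ (1 - θ) * A ^ θ := by gcongr
    _ = (m ^ (1 / 2 : ℝ)) ^ (1 - θ) * (A ^ (1 - θ) * A ^ θ) := by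
        rw [Real.mul_rpow (by positivity) hA]; ring
    _ = m ^ ((1 / 2 : ℝ) - (p⁻¹).toReal) * A := by
        rw [← hsplit A hA, ← Real.rpow_mul hm.le, ENNReal.toReal_inv, ← hr]
        congr 2
        rw [hθ]; ring

open Matrix in
/-- Vectors of `L₂`-orthonormal functions have the identity in the moment hull of their values
on a set of full measure. -/
theorem one_mem_momentHull_of_orthonormal [IsProbabilityMeasure μ] {ι : Type*} [Fintype ι]
    [DecidableEq ι] {g : D → ι → ℂ} {Ω : Set D} (hΩ : ∀ᵐ y ∂μ, y ∈ Ω)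
    (hint : ∀ i j, Integrable (fun y => star (g y i) * g y j) μ)
    (horth : ∀ i j, ∫ y, star (g y i) * g y j ∂μ = if i = j then 1 else 0) :
    1 ∈ momentHull (g '' Ω) := by
  refine ⟨isHermitian_one, fun B hB c h => ?_⟩
  have e : (fun y => star (g y) ⬝ᵥ B *ᵥ g y) =
      fun y => ∑ i, ∑ j, B i j * (star (g y i) * g y j) := by
    ext y
    simp only [dotProduct, mulVec, Finset.mul_sum, Pi.star_apply]
    exact Finset.sum_congr rfl fun i _ => Finset.sum_congr rfl fun j _ => by ring
  have hI : Integrable (fun y => star (g y) ⬝ᵥ B *ᵥ g y) μ := by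
    rw [e]
    exact integrable_finsetSum _ fun i _ => integrable_finsetSum _ fun j _ =>
      (hint i j).const_mul _
  have htr : ∫ y, star (g y) ⬝ᵥ B *ᵥ g y ∂μ = B.trace := by
    rw [e, integral_finsetSum Finset.univ
      (f := fun i y => ∑ j, B i j * (star (g y i) * g y j)) fun i _ =>
        integrable_finsetSum _ fun j _ => (hint i j).const_mul _]
    refine Finset.sum_congr rfl fun i _ => ?_
    rw [integral_finsetSum _ fun j _ => (hint i j).const_mul _]
    simp_rw [integral_const_mul, horth]
    simp [Matrix.diag]
  rw [Matrix.mul_one, ← htr]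
  have hre := integral_re hI
  simp only [RCLike.re_to_complex] at hre
  rw [← hre]
  calc ∫ y, (star (g y) ⬝ᵥ B *ᵥ g y).re ∂μ ≤ ∫ _y, c ∂μ := by
        refine integral_mono_ae hI.re (integrable_const c) ?_
        filter_upwards [hΩ] with y hy
        exact h _ ⟨y, hy, rfl⟩
    _ = c := by simp

/-- The canonical map from a space of square-integrable functions to `L₂`. -/
noncomputable def toL2 (V : Submodule ℂ (D → ℂ)) (hL2 : ∀ f ∈ V, MemLp f 2 μ) :
    V →ₗ[ℂ] Lp ℂ 2 μ where
  toFun f := (hL2 f f.2).toLp f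
  map_add' f g := MemLp.toLp_add (hL2 f f.2) (hL2 g g.2)
  map_smul' c f := MemLp.toLp_const_smul c (hL2 f f.2)

open Matrix in
/-- `L₂`-sampling with `n` points. -/
theorem exists_points_L2 [IsProbabilityMeasure μ] (V : Submodule ℂ (D → ℂ))
    [FiniteDimensional ℂ V] (hL2 : ∀ f ∈ V, MemLp f 2 μ) {n : ℕ}
    (hn : Module.finrank ℂ V < n) :
    ∃ x : Fin n → D, ∀ f ∈ V,
      (√n - √(Module.finrank ℂ V)) ^ 2 * pNorm μ 2 f ^ 2 ≤ ∑ i, ‖f (x i)‖ ^ 2 := by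
  set T := toL2 V hL2 with hT
  -- Nonzero functions in `V` may vanish almost everywhere, so `k` can be smaller than `dim V`; this
  -- only improves the constant.
  set k := Module.finrank ℂ (LinearMap.range T) with hk
  have hkm : k ≤ Module.finrank ℂ V := LinearMap.finrank_range_le T
  have hnorm : ∀ f : V, pNorm μ 2 (f : D → ℂ) = ‖T f‖ := fun f => by
    rw [pNorm_of_ne_top (by simp)]
    exact (Lp.norm_toLp _ (hL2 f f.2)).symm
  let e := stdOrthonormalBasis ℂ (LinearMap.range T)
  have hnormsq : ∀ f : V, ‖T f‖ ^ 2 = ∑ j, ‖e.repr (T.rangeRestrict f) j‖ ^ 2 := fun f => by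
    rw [← EuclideanSpace.norm_sq_eq, e.repr.norm_map]
    rfl
  rcases Nat.eq_zero_or_pos k with hk0 | hkpos
  · have := (Measure.nonempty_of_neZero μ)
    refine ⟨fun _ => Classical.arbitrary D, fun f hf => ?_⟩
    have : IsEmpty (Fin k) := by rw [hk0]; infer_instance
    rw [hnorm ⟨f, hf⟩, hnormsq, Finset.univ_eq_empty, Finset.sum_empty, mul_zero]
    positivity
  have : Nonempty (Fin k) := ⟨⟨0, hkpos⟩⟩
  choose g hg using fun j => (e j).2
  let b := Module.finBasis ℂ V
  -- Expansions in the `L₂`-basis hold only almost everywhere. Finitely many identities, one per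
  -- basis vector of `V`, yield one set of full measure on which they hold pointwise for all of `V`;
  -- the points are drawn from it.
  set Ω : Set D := {y | ∀ i, (b i : D → ℂ) y =
    ∑ j, e.repr (T.rangeRestrict (b i)) j * (g j : D → ℂ) y} with hΩ
  have hΩae : ∀ᵐ y ∂μ, y ∈ Ω := by
    refine ae_all_iff.mpr fun i => ?_
    have h1 : T (b i) = T (∑ j, e.repr (T.rangeRestrict (b i)) j • g j) := by
      have := congrArg Subtype.val (e.sum_repr (T.rangeRestrict (b i)))
      rw [map_sum]
      simp only [map_smul, hg]
      change ((T.rangeRestrict (b i) : LinearMap.range T) : Lp ℂ 2 μ) = _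
      rw [← this]
      simp
    have h2 := (MemLp.toLp_eq_toLp_iff (hL2 _ (b i).2) (hL2 _ (Subtype.property _))).mp h1
    filter_upwards [h2] with y hy
    rw [hy]
    simp
  have hrep : ∀ y ∈ Ω, ∀ f : V, (f : D → ℂ) y =
      ∑ j, e.repr (T.rangeRestrict f) j * (g j : D → ℂ) y := by
    intro y hy f
    let L₁ : V →ₗ[ℂ] ℂ := (LinearMap.proj y).comp V.subtype
    let L₂ : V →ₗ[ℂ] ℂ :=
      { toFun := fun f => ∑ j, e.repr (T.rangeRestrict f) j * (g j : D → ℂ) y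
        map_add' := fun f g => by simp [add_mul, Finset.sum_add_distrib]
        map_smul' := fun c f => by simp [Finset.mul_sum, mul_assoc] }
    have : L₁ = L₂ := b.ext fun i => hy i
    exact LinearMap.congr_fun this f
  have hae : ∀ i, (T (g i) : D → ℂ) =ᵐ[μ] g i := fun i => MemLp.coeFn_toLp (hL2 _ (g i).2)
  have hinner : ∀ i j, (fun y => inner ℂ (T (g i) y) (T (g j) y)) =ᵐ[μ]
      fun y => star ((g i : D → ℂ) y) * (g j : D → ℂ) y := fun i j => by
    filter_upwards [hae i, hae j] with y h1 h2
    rw [h1, h2, RCLike.inner_apply, mul_comm]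
    rfl
  have hone := one_mem_momentHull_of_orthonormal (g := fun y j => (g j : D → ℂ) y) hΩae
    (fun i j => (L2.integrable_inner (T (g i)) (T (g j))).congr (hinner i j))
    (fun i j => by
      rw [← integral_congr_ae (hinner i j), ← L2.inner_def, hg, hg]
      exact (orthonormal_iff_ite.mp e.orthonormal) i j)
  obtain ⟨v, hv, hframe⟩ := exists_frame_lower_bound hone (n := n)
    (by rw [Fintype.card_fin]; omega)
  choose x hx hxv using hv
  refine ⟨x, fun f hf => ?_⟩
  have h1 := hframe (e.repr (T.rangeRestrict ⟨f, hf⟩))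
  rw [← hnormsq, ← hnorm, Fintype.card_fin] at h1
  have h2 : ∀ i, v i ⬝ᵥ (e.repr (T.rangeRestrict ⟨f, hf⟩)) = f (x i) := fun i => by
    have := hrep (x i) (hx i) ⟨f, hf⟩
    rw [← hxv i, dotProduct_comm]
    exact this.symm
  simp only [h2] at h1
  refine le_trans ?_ h1
  have h3 : √(k : ℝ) ≤ √(Module.finrank ℂ V : ℝ) := Real.sqrt_le_sqrt (by exact_mod_cast hkm)
  have h4 : √(Module.finrank ℂ V : ℝ) ≤ √(n : ℝ) := Real.sqrt_le_sqrt (by exact_mod_cast hn.le)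
  gcongr

end Sampling

/-! ### Coordinates, normalization and the two endpoint cases -/

section Points

/-- Coordinates on an `m`-dimensional space of bounded functions: evaluation at `y` is pairing with
`u y`. -/
theorem exists_coordinate_functions {D : Type*} {m : ℕ} (hm : 1 ≤ m) (V : Submodule ℂ (D → ℂ))
    (hdim : Module.finrank ℂ V = m) (hB : ∀ f ∈ V, ∃ C : ℝ, ∀ x, ‖f x‖ ≤ C) :
    ∃ u : D → Fin m → ℂ, (∃ R : ℝ, ∀ y i, ‖u y i‖ ≤ R) ∧
      (∀ c : Fin m → ℂ, (∀ y, u y ⬝ᵥ c = 0) → c = 0) ∧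
      ∀ f ∈ V, ∃ c : Fin m → ℂ, ∀ y, f y = u y ⬝ᵥ c := by
  have : FiniteDimensional ℂ V := .of_finrank_pos (by omega)
  let b := Module.finBasisOfFinrankEq ℂ V hdim
  have hsum : ∀ (c : Fin m → ℂ) (y : D),
      ((∑ i, c i • b i : V) : D → ℂ) y = (fun i => (b i : D → ℂ) y) ⬝ᵥ c := fun c y => by
    simp [dotProduct, mul_comm]
  refine ⟨fun y i => (b i : D → ℂ) y, ?_, fun c hc => ?_, fun f hf => ⟨b.repr ⟨f, hf⟩, fun y => ?_⟩⟩
  · choose C hC using fun i => hB _ (b i).2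
    refine ⟨∑ i, |C i|, fun y i => ((hC i y).trans (le_abs_self _)).trans ?_⟩
    exact Finset.single_le_sum (f := fun i => |C i|) (fun j _ => abs_nonneg _) (Finset.mem_univ i)
  · have h0 : ∑ i, c i • b i = 0 := Subtype.ext (funext fun y => (hsum c y).trans (hc y))
    exact funext (Fintype.linearIndependent_iff.mp b.linearIndependent c h0)
  · rw [← hsum, b.sum_repr]

theorem one_sub_sqrt_div_mul_sqrt {m n : ℝ} (hn : 0 < n) (hm : 0 ≤ m) :
    (1 - √(m / n)) * √n = √n - √m := by
  rw [sub_mul, one_mul, Real.sqrt_div hm, div_mul_cancel₀ _ (Real.sqrt_pos.mpr hn).ne']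

/-- Turns a squared frame inequality into the normalized one. -/
theorem one_sub_sqrt_mul_le {m n N a S : ℝ} (hm : 0 ≤ m) (hn : 0 < n) (ha : 0 ≤ a)
    (hS : (√n - √m) ^ 2 * N ^ 2 ≤ a * S) :
    (1 - √(m / n)) * N ≤ √a * √(1 / n * S) := by
  rw [← Real.sqrt_mul ha]
  refine Real.le_sqrt_of_sq_le ?_
  have h := one_sub_sqrt_div_mul_sqrt hn hm
  rw [← h, mul_pow, Real.sq_sqrt hn.le] at hS
  have : ((1 - √(m / n)) * N) ^ 2 * n ≤ a * S := by nlinarith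
  rw [← le_div_iff₀ hn] at this
  calc ((1 - √(m / n)) * N) ^ 2 ≤ a * S / n := this
    _ = a * (1 / n * S) := by ring

theorem exists_points_of_two_of_top {D : Type*} [MeasurableSpace D] {μ : Measure D}
    [IsProbabilityMeasure μ] {m : ℕ} (hm : 1 ≤ m)
    (V : Submodule ℂ (D → ℂ)) (hdim : Module.finrank ℂ V = m) (hL2 : ∀ f ∈ V, MemLp f 2 μ)
    (hB : ∀ f ∈ V, ∃ C : ℝ, ∀ x, ‖f x‖ ≤ C) {n : ℕ} {c : ℝ} (hmn : m ≤ n)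
    (hc : c = 1 - √((m : ℝ) / (n : ℝ)) ∨ (n = m ∧ c = 1 / (2 * (m : ℝ))))
    {p : ℝ≥0∞} (hp : p = 2 ∨ p = ∞) :
    ∃ x : Fin n → D, ∀ f ∈ V, c * pNorm μ p f ≤
      (m : ℝ) ^ ((1 / 2 : ℝ) - (p⁻¹).toReal) * √((1 / (n : ℝ)) * ∑ i, ‖f (x i)‖ ^ 2) := by
  have hD : Nonempty D := Measure.nonempty_of_neZero μ
  have : FiniteDimensional ℂ V := .of_finrank_pos (by omega)
  have : Nonempty (Fin m) := ⟨⟨0, hm⟩⟩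
  have hm0 : (0 : ℝ) < m := by exact_mod_cast hm
  have hn0 : (0 : ℝ) < n := by exact_mod_cast (by omega : 0 < n)
  obtain ⟨u, ⟨R, hR⟩, hu, hV⟩ := exists_coordinate_functions hm V hdim hB
  rcases hc with rfl | ⟨rfl, rfl⟩
  · rcases hmn.eq_or_lt with rfl | hlt
    · refine ⟨fun _ => Classical.arbitrary D, fun f _ => ?_⟩
      rw [div_self hm0.ne', Real.sqrt_one, sub_self, zero_mul]
      positivity
    rcases hp with rfl | rfl
    · obtain ⟨x, hx⟩ := exists_points_L2 V hL2 (n := n) (by omega)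
      refine ⟨x, fun f hf => ?_⟩
      have h := one_sub_sqrt_mul_le (N := pNorm μ 2 f) (S := ∑ i, ‖f (x i)‖ ^ 2) hm0.le hn0
        zero_le_one (by rw [one_mul, ← hdim]; exact hx f hf)
      have e : (1 / 2 : ℝ) - ((2 : ℝ≥0∞)⁻¹).toReal = 0 := by norm_num
      rw [Real.sqrt_one] at h
      rwa [e, Real.rpow_zero]
    · obtain ⟨x, hx⟩ := exists_points_sup u hR hu (n := n) (by rwa [Fintype.card_fin])
      refine ⟨x, fun f hf => ?_⟩
      obtain ⟨a, ha⟩ := hV f hf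
      have hpt : ∀ y, (1 - √((m : ℝ) / n)) * ‖f y‖ ≤
          √m * √(1 / n * ∑ i, ‖f (x i)‖ ^ 2) := fun y => by
        refine one_sub_sqrt_mul_le hm0.le hn0 hm0.le ?_
        have := hx a y
        rw [Fintype.card_fin] at this
        simpa only [ha] using this
      have hc0 : 0 ≤ 1 - √((m : ℝ) / n) := by
        rw [sub_nonneg, Real.sqrt_le_one, div_le_one hn0]
        exact_mod_cast hmn
      rw [pNorm_top, Real.mul_iSup_of_nonneg hc0, ENNReal.inv_top, ENNReal.toReal_zero, sub_zero,
        ← Real.sqrt_eq_rpow]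
      exact ciSup_le hpt
  · obtain ⟨x, hx⟩ := exists_fekete_points u hR hu
    refine ⟨x, fun f hf => ?_⟩
    obtain ⟨a, ha⟩ := hV f hf
    set S := ∑ i, ‖f (x i)‖ ^ 2
    have hS0 : 0 ≤ S := Finset.sum_nonneg fun i _ => sq_nonneg _
    have hsum : ∑ i, ‖f (x i)‖ ≤ n * √(1 / n * S) := by
      have h1 : (∑ i, ‖f (x i)‖) ^ 2 ≤ n * S := by
        simpa using sq_sum_le_card_mul_sum_sq (s := Finset.univ) (f := fun i => ‖f (x i)‖)
      refine (Real.le_sqrt_of_sq_le h1).trans_eq ?_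
      have : n * S = (n : ℝ) ^ 2 * (1 / n * S) := by field_simp
      rw [this, Real.sqrt_mul (by positivity), Real.sqrt_sq hn0.le]
    have htop : pNorm μ ∞ f ≤ 2 * n * √(1 / n * S) := by
      rw [pNorm_top]
      refine ciSup_le fun y => ?_
      have := hx a y
      simp only [← ha] at this
      linarith
    have hpn : pNorm μ p f ≤ pNorm μ ∞ f := by
      rcases hp with rfl | rfl
      · exact pNorm_two_le_pNorm_top (hB f hf)
      · exact le_rfl
    have hpow : (1 : ℝ) ≤ (n : ℝ) ^ ((1 / 2 : ℝ) - (p⁻¹).toReal) := by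
      refine Real.one_le_rpow (by exact_mod_cast hm) ?_
      rcases hp with rfl | rfl <;> norm_num
    calc 1 / (2 * (n : ℝ)) * pNorm μ p f ≤ 1 / (2 * (n : ℝ)) * (2 * n * √(1 / n * S)) := by
          gcongr
          exact hpn.trans htop
      _ = 1 * √(1 / n * S) := by field_simp
      _ ≤ _ := by gcongr

end Points

/-! ### Assembly of the endpoint cases -/

theorem proposition2p3 {D : Type*} [MeasurableSpace D] (μ : Measure D) [IsProbabilityMeasure μ]
    (m : ℕ) (hm : 1 ≤ m) (V : Submodule ℂ (D → ℂ)) (hdim : Module.finrank ℂ V = m)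
    (hL2 : ∀ f ∈ V, MemLp f 2 μ) (hB : ∀ f ∈ V, ∃ C : ℝ, ∀ x, ‖f x‖ ≤ C) :
    -- `c` is the factor on the left: `1 - √(m/n)`, or also `1/(2m)` when `n = m`
    (∀ (n : ℕ) (c : ℝ), m ≤ n →
      (c = 1 - √((m : ℝ) / (n : ℝ)) ∨ (n = m ∧ c = 1 / (2 * (m : ℝ)))) →
      -- `2n` points, simultaneously for all `f` and all `2 ≤ p ≤ ∞`
      (∃ x : Fin (2 * n) → D, ∀ f ∈ V, ∀ p : ℝ≥0∞, 2 ≤ p →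
        c * pNorm μ p f ≤
          (m : ℝ) ^ ((1 / 2 : ℝ) - (p⁻¹).toReal) *
            √((1 / (n : ℝ)) * ∑ i, ‖f (x i)‖ ^ 2)) ∧
      -- `n` points for each of `p = 2` and `p = ∞`
      (∀ p : ℝ≥0∞, p = 2 ∨ p = ∞ → ∃ x : Fin n → D, ∀ f ∈ V,
        c * pNorm μ p f ≤
          (m : ℝ) ^ ((1 / 2 : ℝ) - (p⁻¹).toReal) *
            √((1 / (n : ℝ)) * ∑ i, ‖f (x i)‖ ^ 2))) ∧
    -- the consequence for the supremum norm with `2m` points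
    (∃ x : Fin (2 * m) → D, ∀ f ∈ V,
      pNorm μ ∞ f ≤ (2 + √2) * √(m : ℝ) * ⨆ i, ‖f (x i)‖) := by
  have hm0 : (0 : ℝ) < m := by exact_mod_cast hm
  refine ⟨fun n c hmn hc => ⟨?_, fun p hp =>
    exists_points_of_two_of_top hm V hdim hL2 hB hmn hc hp⟩, ?_⟩
  · have hn0 : (0 : ℝ) < n := by exact_mod_cast (by omega : 0 < n)
    have hc0 : 0 ≤ c := by
      rcases hc with rfl | ⟨rfl, rfl⟩
      · rw [sub_nonneg, Real.sqrt_le_one, div_le_one hn0]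
        exact_mod_cast hmn
      · positivity
    obtain ⟨x, hx⟩ := exists_points_of_two_of_top hm V hdim hL2 hB hmn hc (.inl rfl)
    obtain ⟨z, hz⟩ := exists_points_of_two_of_top (μ := μ) hm V hdim hL2 hB hmn hc (.inr rfl)
    -- The weight stays `1/n` for `2n` points, so discarding either half of the sum leaves the
    -- corresponding endpoint bound.
    refine ⟨Fin.append x z ∘ finCongr (two_mul n), fun f hf p hp => ?_⟩
    have hsum : ∑ i, ‖f ((Fin.append x z ∘ finCongr (two_mul n)) i)‖ ^ 2 =
        ∑ i, ‖f (x i)‖ ^ 2 + ∑ i, ‖f (z i)‖ ^ 2 := by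
      rw [← Equiv.sum_comp (finCongr (two_mul n)).symm, Fin.sum_univ_add]
      simp only [Function.comp_apply, Equiv.apply_symm_apply, Fin.append_left, Fin.append_right]
    have hx0 : 0 ≤ ∑ i, ‖f (x i)‖ ^ 2 := Finset.sum_nonneg fun i _ => sq_nonneg _
    have hz0 : 0 ≤ ∑ i, ‖f (z i)‖ ^ 2 := Finset.sum_nonneg fun i _ => sq_nonneg _
    rw [hsum]
    refine mul_pNorm_le_of_two_of_top (hB f hf) (hL2 f hf) hc0 (Real.sqrt_nonneg _) hm0 ?_ ?_ hp
    · refine (hx f hf).trans ?_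
      have e : (1 / 2 : ℝ) - ((2 : ℝ≥0∞)⁻¹).toReal = 0 := by norm_num
      rw [e, Real.rpow_zero, one_mul]
      gcongr
      linarith
    · refine (hz f hf).trans ?_
      rw [ENNReal.inv_top, ENNReal.toReal_zero, sub_zero]
      gcongr
      linarith
  · obtain ⟨x, hx⟩ := exists_points_of_two_of_top (μ := μ) (n := 2 * m) hm V hdim hL2 hB
      (by omega) (.inl rfl) (.inr rfl)
    refine ⟨x, fun f hf => ?_⟩
    have h := hx f hf
    set A := ⨆ i, ‖f (x i)‖
    have hA : ∀ i, ‖f (x i)‖ ≤ A := fun i =>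
      le_ciSup (f := fun i => ‖f (x i)‖) (Set.finite_range _).bddAbove i
    have hA0 : 0 ≤ A := Real.iSup_nonneg fun i => norm_nonneg _
    have hsum : ∑ i, ‖f (x i)‖ ^ 2 ≤ (2 * m : ℕ) * A ^ 2 := by
      calc ∑ i, ‖f (x i)‖ ^ 2 ≤ ∑ _i : Fin (2 * m), A ^ 2 := by
            gcongr with i
            exact hA i
        _ = _ := by simp
    have hrms : √(1 / ((2 * m : ℕ) : ℝ) * ∑ i, ‖f (x i)‖ ^ 2) ≤ A := by
      rw [Real.sqrt_le_left hA0, one_div, inv_mul_le_iff₀ (by positivity)]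
      exact hsum
    have hfac : (m : ℝ) / (2 * m : ℕ) = 1 / 2 := by push_cast; field_simp
    rw [hfac, ENNReal.inv_top, ENNReal.toReal_zero, sub_zero, ← Real.sqrt_eq_rpow] at h
    have h' : (1 - √(1 / 2)) * pNorm μ ∞ f ≤ √m * A := h.trans (by gcongr)
    have hs : √(1 / 2 : ℝ) = √2 / 2 := by
      rw [Real.sqrt_div zero_le_one, Real.sqrt_one, div_eq_div_iff (by positivity) (by positivity)]
      nlinarith [Real.sq_sqrt (show (0 : ℝ) ≤ 2 by norm_num)]
    have h2 : √2 ^ 2 = (2 : ℝ) := Real.sq_sqrt (by norm_num)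
    -- At `n = 2m` the factor is `1 - √(1/2)`, whose reciprocal is `2 + √2`.
    calc pNorm μ ∞ f = (2 + √2) * ((1 - √(1 / 2)) * pNorm μ ∞ f) := by
          rw [hs]; linear_combination (pNorm μ ∞ f / 2) * h2
      _ ≤ (2 + √2) * (√m * A) := by gcongr
      _ = _ := by ring
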